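/- For $d\in\mathbb N$ let $\mathcal S_d$ be the set of quantum states on $\mathbb C^d$, i.e. of positive semidefinite complex $d\times d$ matrices of trace $1$. A probability distribution $p$ on $\{1,\dots,d\}$ is identified with the diagonal state $\mathrm{diag}(p(1),\dots,p(d))\in\mathcal S_d$. A CPTP map is a completely positive, trace-preserving linear map $M_n(\mathbb C)\to M_m(\mathbb C)$. Let $F(p,q)=\sum_x\sqrt{p(x)}\sqrt{q(x)}$ be the classical fidelity of two probability distributions on the same finite set, and let $F(\rho,\sigma)=\mathrm{tr}\sqrt{\sqrt\sigma\,\rho\,\sqrt\sigma}$ be the (Uhlmann) fidelity of two states. A reverse test of $\{\rho,\sigma\}$, where $\rho,\sigma\in\mathcal S_d$, is a triple $(\Phi,\{p,q\})$ consisting of probability distributions $p,q$ on a common finite set $\{1,\dots,d'\}$ ($d'$ arbitrary) and a CPTP map $\Phi$ with $\Phi(p)=\rho$ and $\Phi(q)=\sigma$. Put $$F_{\min}(\rho,\sigma):=\max\{F(p,q) : (\Phi,\{p,q\})\text{ is a reverse test of }\{\rho,\sigma\}\}.$$ Consider families $F^Q=(F^Q_d)_{d\in\mathbb N}$ of functions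 $F^Q_d:\mathcal S_d\times\mathcal S_d\to\mathbb R$ (the index $d$ is suppressed below) and the properties (N) $F^Q(p,q)=F(p,q)$ for all $d$ and all probability distributions $p,q$ on $\{1,\dots,d\}$; (M) $F^Q(\rho,\sigma)\le F^Q(\Lambda(\rho),\Lambda(\sigma))$ for all $n,m$, all $\rho,\sigma\in\mathcal S_n$ and all CPTP maps $\Lambda:M_n(\mathbb C)\to M_m(\mathbb C)$. **Theorem.** (i) If $F^Q$ satisfies (N) and (M), then $F_{\min}(\rho,\sigma)\le F^Q(\rho,\sigma)\le F(\rho,\sigma)$ for all $d$ and all $\rho,\sigma\in\mathcal S_d$. (ii) The maximum defining $F_{\min}(\rho,\sigma)$ exists for all $d$ and all $\rho,\sigma\in\mathcal S_d$, and $F_{\min}$ satisfies (N) and (M). In particular, $F_{\min}$ is the smallest quantity satisfying (N) and (M). -/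

import Mathlib

open scoped ComplexOrder MatrixOrder Matrix.Norms.L2Operator CStarAlgebra

noncomputable section

namespace QFid

/-- The quantum states of a `d`-dimensional Hilbert space `ℂ^d`: the positive semidefinite
`d × d` matrices of trace one. -/
def State (d : ℕ) : Type :=
  {ρ : Matrix (Fin d) (Fin d) ℂ // ρ.PosSemidef ∧ ρ.trace = 1}

/-- The probability distributions on a set with `d` elements. -/
abbrev PDist (d : ℕ) : Type := stdSimplex ℝ (Fin d)

/-- A probability distribution, regarded as a (diagonal) quantum state. -/
def ofDist {d : ℕ} (p : PDist d) : State d :=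
  ⟨Matrix.diagonal fun x => ((p.1 x : ℝ) : ℂ), by
    constructor
    · rw [Matrix.posSemidef_diagonal_iff]
      intro x
      exact_mod_cast p.2.1 x
    · rw [Matrix.trace_diagonal]
      exact_mod_cast p.2.2⟩

/-- CPTP maps: completely positive (in the sense of Mathlib) linear maps
`M_n(ℂ) → M_m(ℂ)` that preserve the trace. -/
structure Channel (n m : ℕ) where
  toCP : Matrix (Fin n) (Fin n) ℂ →CP Matrix (Fin m) (Fin m) ℂ
  trace_map : ∀ A, (toCP A).trace = A.trace

/-- The image of a state under a CPTP map. -/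
def Channel.app {n m : ℕ} (Φ : Channel n m) (ρ : State n) : State m :=
  ⟨Φ.toCP ρ.1, Matrix.nonneg_iff_posSemidef.mp
      (map_nonneg Φ.toCP (Matrix.nonneg_iff_posSemidef.mpr ρ.2.1)),
    (Φ.trace_map ρ.1).trans ρ.2.2⟩

/-- Classical fidelity `F(p, q) = ∑ₓ √p(x) √q(x)`. -/
def classicalFidelity {d : ℕ} (p q : PDist d) : ℝ :=
  ∑ x, Real.sqrt (p.1 x) * Real.sqrt (q.1 x)

/-- Uhlmann fidelity `F(ρ, σ) = tr √(√σ ρ √σ)`. -/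
def uhlmannFidelity {d : ℕ} (ρ σ : State d) : ℝ :=
  (Matrix.trace (CFC.sqrt (CFC.sqrt σ.1 * ρ.1 * CFC.sqrt σ.1))).re

/-- A reverse test of `{ρ, σ}`: a CPTP map `Φ` together with distributions `p`, `q` on some finite
set such that `Φ(p) = ρ` and `Φ(q) = σ`. -/
structure ReverseTest {d : ℕ} (ρ σ : State d) where
  card : ℕ
  chan : Channel card d
  p : PDist card
  q : PDist card
  map_p : chan.app (ofDist p) = ρ
  map_q : chan.app (ofDist q) = σ

/-- The values `F(p, q)` over all reverse tests `(Φ, {p, q})` of `{ρ, σ}`. -/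
def reverseTestValues {d : ℕ} (ρ σ : State d) : Set ℝ :=
  Set.range fun R : ReverseTest ρ σ => classicalFidelity R.p R.q

/-- `F_min(ρ, σ)`, the maximum of `F(p, q)` over all reverse tests of `{ρ, σ}`. It is written as a
supremum here; that the supremum is attained is part of the theorem. -/
def fMin (d : ℕ) (ρ σ : State d) : ℝ := sSup (reverseTestValues ρ σ)

/-- Property (N): the quantity agrees with classical fidelity on probability distributions. -/
def Normalized (FQ : ∀ d : ℕ, State d → State d → ℝ) : Prop :=
  ∀ (d : ℕ) (p q : PDist d), FQ d (ofDist p) (ofDist q) = classicalFidelity p q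

/-- Property (M): the quantity does not decrease under CPTP maps. -/
def MonotoneCPTP (FQ : ∀ d : ℕ, State d → State d → ℝ) : Prop :=
  ∀ (n m : ℕ) (Φ : Channel n m) (ρ σ : State n), FQ n ρ σ ≤ FQ m (Φ.app ρ) (Φ.app σ)

end QFid

end

noncomputable section

namespace QFid

open Matrix

/-! Both bounds are monotonicity applied to a well-chosen channel. Applied to the channel of an
optimal reverse test, (M) and (N) give the lower bound (`fMin_le`). Applied to a measurement whose
outcome distributions have classical fidelity equal to the Uhlmann fidelity, they give the upper
bound; the Fuchs–Caves construction supplies this measurement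
(`exists_measurement_classicalFidelity_eq`).

For attainment, the difficulty is that the classical alphabet is unbounded. Only the prepared states
and their weights matter, so up to a factor 1/2 a reverse test is a convex combination of points of
the compact set `splitTriples`. Its convex hull is compact by Carathéodory, and the reverse test
values are a rescaled slice of it (`isCompact_reverseTestValues`).

For `fMin` itself, (M) holds because a channel can be composed with a reverse test, and (N) is the
classical data-processing inequality, a Cauchy–Schwarz estimate. -/

lemma exists_eq_star_mul_self {A : Type*} [NonUnitalCStarAlgebra A] [PartialOrder A]
    [StarOrderedRing A] {a : A} (ha : 0 ≤ a) : ∃ b : A, a = star b * b :=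
  CStarAlgebra.nonneg_iff_eq_star_mul_self.mp ha

lemma cStarMatrix_sum_apply {A κ m n : Type*} [AddCommMonoid A] (s : Finset κ)
    (f : κ → CStarMatrix m n A) (i : m) (j : n) : (∑ x ∈ s, f x) i j = ∑ x ∈ s, f x i j :=
  Matrix.sum_apply i j s f

/-! ### Completely positive maps, measure-and-prepare channels and reverse tests. -/

section CompletelyPositive

variable {A B C : Type*} [NonUnitalCStarAlgebra A] [NonUnitalCStarAlgebra B]
  [NonUnitalCStarAlgebra C] [PartialOrder A] [PartialOrder B] [PartialOrder C]
  [StarOrderedRing A] [StarOrderedRing B] [StarOrderedRing C]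

/-- Composition of completely positive maps. -/
def cpComp (ψ : B →CP C) (φ : A →CP B) : A →CP C where
  toLinearMap := ψ.toLinearMap ∘ₗ φ.toLinearMap
  map_cstarMatrix_nonneg' k M hM :=
    ψ.map_cstarMatrix_nonneg' k _ (φ.map_cstarMatrix_nonneg' k M hM)

/-- A linear map of the form `star a * b ↦ ∑ s, star (c s a) * c s b` is completely positive. -/
lemma map_cstarMatrix_nonneg_of_eq_sum {κ : Type*} [Fintype κ] (φ : A →ₗ[ℂ] B) (c : κ → A → B)
    (h : ∀ a b, φ (star a * b) = ∑ s, star (c s a) * c s b) (k : ℕ)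
    (M : CStarMatrix (Fin k) (Fin k) A) (hM : 0 ≤ M) : 0 ≤ M.map φ := by
  obtain ⟨N, rfl⟩ := exists_eq_star_mul_self hM
  have key : (star N * N).map φ = ∑ s, star (N.map (c s)) * N.map (c s) := by
    ext i j
    simp_rw [cStarMatrix_sum_apply, CStarMatrix.map_apply, CStarMatrix.mul_apply,
      CStarMatrix.star_apply, map_sum, h, CStarMatrix.map_apply]
    exact Finset.sum_comm
  rw [key]
  exact Finset.sum_nonneg fun s _ => star_mul_self_nonneg _

end CompletelyPositive

/-- Composition of channels. -/
def Channel.comp {l n m : ℕ} (Ψ : Channel n m) (Φ : Channel l n) : Channel l m where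
  toCP := cpComp Ψ.toCP Φ.toCP
  trace_map A := (Ψ.trace_map (Φ.toCP A)).trans (Φ.trace_map A)

lemma Channel.comp_app {l n m : ℕ} (Ψ : Channel n m) (Φ : Channel l n) (ρ : State l) :
    (Ψ.comp Φ).app ρ = Ψ.app (Φ.app ρ) := rfl

/-- The linear map that prepares `ω x` with the weight `⟨v x, A v x⟩`. -/
def measurePrepareLin {n m : ℕ} {ι : Type*} [Fintype ι] (v : ι → Fin n → ℂ)
    (ω : ι → State m) : Matrix (Fin n) (Fin n) ℂ →ₗ[ℂ] Matrix (Fin m) (Fin m) ℂ where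
  toFun A := ∑ x, (star (v x) ⬝ᵥ A *ᵥ v x) • (ω x).1
  map_add' A B := by
    simp [add_mulVec, add_smul, Finset.sum_add_distrib]
  map_smul' c A := by
    simp [smul_mulVec, Finset.smul_sum, mul_smul]

/-- Expanding the inner product of `a v` and `b v` in coordinates and splitting each state as `√ω *
√ω` gives the form that forces complete positivity. -/
lemma measurePrepareLin_star_mul {n m : ℕ} {ι : Type*} [Fintype ι] (v : ι → Fin n → ℂ)
    (ω : ι → State m) (a b : Matrix (Fin n) (Fin n) ℂ) :
    measurePrepareLin v ω (star a * b) = ∑ s : ι × Fin n,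
      star ((a *ᵥ v s.1) s.2 • CFC.sqrt (ω s.1).1) * ((b *ᵥ v s.1) s.2 • CFC.sqrt (ω s.1).1) := by
  rw [Fintype.sum_prod_type]
  refine Finset.sum_congr rfl fun x _ => ?_
  have hs : CFC.sqrt (ω x).1 * CFC.sqrt (ω x).1 = (ω x).1 :=
    CFC.sqrt_mul_sqrt_self _ (nonneg_iff_posSemidef.mpr (ω x).2.1)
  have hs' : star (CFC.sqrt (ω x).1) = CFC.sqrt (ω x).1 :=
    (IsSelfAdjoint.of_nonneg (CFC.sqrt_nonneg _)).star_eq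
  simp_rw [star_smul, hs', smul_mul_smul_comm, hs, ← Finset.sum_smul]
  congr 1
  rw [star_eq_conjTranspose, ← mulVec_mulVec, dotProduct_mulVec, vecMul_conjTranspose, star_star]
  rfl

lemma trace_eq_sum_dotProduct {n : ℕ} {ι : Type*} [Fintype ι] {v : ι → Fin n → ℂ}
    (hv : ∑ x, vecMulVec (v x) (star (v x)) = 1) (A : Matrix (Fin n) (Fin n) ℂ) :
    A.trace = ∑ x, star (v x) ⬝ᵥ A *ᵥ v x := by
  conv_lhs => rw [← mul_one A, ← hv, Finset.mul_sum, trace_sum]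
  refine Finset.sum_congr rfl fun x _ => ?_
  rw [mul_vecMulVec, trace_vecMulVec, dotProduct_comm]

/-- The channel that measures in a tight frame `v` and prepares the states `ω`. -/
def measurePrepare {n m : ℕ} {ι : Type*} [Fintype ι] (v : ι → Fin n → ℂ) (ω : ι → State m)
    (hv : ∑ x, vecMulVec (v x) (star (v x)) = 1) : Channel n m where
  toCP :=
    { toLinearMap := measurePrepareLin v ω
      map_cstarMatrix_nonneg' := 
        map_cstarMatrix_nonneg_of_eq_sum _ _ (measurePrepareLin_star_mul v ω) }
  trace_map := fun A => by
    change (∑ x, (star (v x) ⬝ᵥ A *ᵥ v x) • (ω x).1).trace = _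
    simp_rw [trace_sum, trace_smul, (ω _).2.2, smul_eq_mul, mul_one]
    exact (trace_eq_sum_dotProduct hv A).symm

lemma measurePrepare_app {n m : ℕ} {ι : Type*} [Fintype ι] (v : ι → Fin n → ℂ)
    (ω : ι → State m) (hv : ∑ x, vecMulVec (v x) (star (v x)) = 1) (ρ : State n) :
    ((measurePrepare v ω hv).app ρ).1 = ∑ x, (star (v x) ⬝ᵥ ρ.1 *ᵥ v x) • (ω x).1 := rfl

/-- The point mass at `x`. -/
def pointMass {d : ℕ} (x : Fin d) : PDist d := ⟨Pi.single x 1, single_mem_stdSimplex ℝ x⟩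

lemma coe_ofDist {d : ℕ} (p : PDist d) :
    (ofDist p).1 = ∑ x, ((p.1 x : ℝ) : ℂ) • (ofDist (pointMass x)).1 := by
  ext i j
  rw [Matrix.sum_apply]
  simp only [ofDist, pointMass, Matrix.smul_apply, diagonal_apply, Pi.single_apply, apply_ite,
    Complex.ofReal_one, Complex.ofReal_zero]
  rcases eq_or_ne i j with rfl | h <;> simp [*]

lemma coe_app_ofDist {n d : ℕ} (Φ : Channel n d) (p : PDist n) :
    (Φ.app (ofDist p)).1 = ∑ x, ((p.1 x : ℝ) : ℂ) • (Φ.app (ofDist (pointMass x))).1 := by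
  change Φ.toCP (ofDist p).1 = _
  rw [coe_ofDist, map_sum]
  exact Finset.sum_congr rfl fun x _ => map_smul _ _ _

lemma sum_vecMulVec_single {n : ℕ} :
    ∑ x : Fin n, vecMulVec (Pi.single x (1 : ℂ)) (star (Pi.single x (1 : ℂ))) = 1 := by
  ext i j
  rw [Matrix.sum_apply]
  simp [vecMulVec_apply, Pi.single_apply, one_apply]

/-- The channel that prepares `ω x` on the classical input `x`. -/
def prepare {n m : ℕ} (ω : Fin n → State m) : Channel n m :=
  measurePrepare (fun x => Pi.single x 1) ω sum_vecMulVec_single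

lemma prepare_app_ofDist {n m : ℕ} (ω : Fin n → State m) (p : PDist n) :
    ((prepare ω).app (ofDist p)).1 = ∑ x, ((p.1 x : ℝ) : ℂ) • (ω x).1 := by
  rw [prepare, measurePrepare_app]
  refine Finset.sum_congr rfl fun x _ => ?_
  congr 1
  simp [ofDist, mulVec_diagonal, dotProduct, Pi.single_apply]

/-- The reverse test with prescribed prepared states. -/
def ReverseTest.ofStates {d n : ℕ} {ρ σ : State d} (p q : PDist n) (ω : Fin n → State d)
    (hp : ρ.1 = ∑ x, ((p.1 x : ℝ) : ℂ) • (ω x).1) (hq : σ.1 = ∑ x, ((q.1 x : ℝ) : ℂ) • (ω x).1) :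
    ReverseTest ρ σ where
  card := n
  chan := prepare ω
  p := p
  q := q
  map_p := Subtype.ext ((prepare_app_ofDist ω p).trans hp.symm)
  map_q := Subtype.ext ((prepare_app_ofDist ω q).trans hq.symm)

/-! ### Compactness of the set of reverse test values. -/

/-- In finite dimension, the convex hull of a compact set is compact. -/
lemma isCompact_convexHull {E : Type*} [AddCommGroup E] [Module ℝ E] [TopologicalSpace E]
    [ContinuousAdd E] [ContinuousSMul ℝ E] [FiniteDimensional ℝ E] {s : Set E}
    (hs : IsCompact s) : IsCompact (convexHull ℝ s) := by
  rcases s.eq_empty_or_nonempty with rfl | ⟨z₀, hz₀⟩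
  · simp
  -- Carathéodory's bound on the number of points; shorter combinations are padded with weight 0 at
  -- `z₀`.
  set N := Module.finrank ℝ E + 1
  have hc : IsCompact ((stdSimplex ℝ (Fin N)) ×ˢ (Set.univ.pi fun _ : Fin N => s)) :=
    (isCompact_stdSimplex ℝ _).prod (isCompact_univ_pi fun _ => hs)
  have hf : Continuous fun y : (Fin N → ℝ) × (Fin N → E) => ∑ i, y.1 i • y.2 i := by fun_prop
  convert hc.image hf using 1
  ext x
  constructor
  · intro hx
    obtain ⟨ι, _, z, w, hz, hind, hw, hw1, rfl⟩ := eq_pos_convex_span_of_mem_convexHull hx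
    have hcard : Fintype.card ι ≤ Fintype.card (Fin N) := by
      rw [Fintype.card_fin]
      exact hind.card_le_finrank_succ.trans (Nat.succ_le_succ (Submodule.finrank_le _))
    obtain ⟨e⟩ := Function.Embedding.nonempty_of_card_le hcard
    have hw' : ∀ j, j ∉ Set.range e → Function.extend e w 0 j = 0 := fun j hj =>
      Function.extend_apply' _ _ _ (by simpa using hj)
    refine ⟨(Function.extend e w 0, Function.extend e z fun _ => z₀), ⟨⟨fun j => ?_, ?_⟩, ?_⟩, ?_⟩
    · by_cases hj : j ∈ Set.range e
      · obtain ⟨i, rfl⟩ := hj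
        simpa [e.injective.extend_apply] using (hw i).le
      · exact (hw' j hj).ge
    · rw [Fintype.sum_of_injective e e.injective w _ hw'
        fun i => (e.injective.extend_apply w 0 i).symm] at hw1
      exact hw1
    · intro j _
      by_cases hj : j ∈ Set.range e
      · obtain ⟨i, rfl⟩ := hj
        simpa [e.injective.extend_apply] using hz ⟨i, rfl⟩
      · simpa [Function.extend_apply' z _ j (by simpa using hj)] using hz₀
    · refine (Fintype.sum_of_injective e e.injective _ _ (fun j hj => ?_) fun i => ?_).symm
      · simp [hw' j hj]
      · simp [e.injective.extend_apply]
  · rintro ⟨⟨w, z⟩, ⟨⟨hw0, hw1⟩, hz⟩, rfl⟩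
    exact mem_convexHull_of_exists_fintype w z hw0 hw1 (fun i => hz i trivial) rfl

/-- States are exactly the `Bᴴ * B` with `B` on the Frobenius unit sphere; `EuclideanSpace` is there
to provide the Frobenius norm. -/
lemma isCompact_states (d : ℕ) :
    IsCompact {A : Matrix (Fin d) (Fin d) ℂ | A.PosSemidef ∧ A.trace = 1} := by
  let toMat : EuclideanSpace ℂ (Fin d × Fin d) → Matrix (Fin d) (Fin d) ℂ :=
    fun b => Matrix.of fun i j => b (i, j)
  have htoMat : Continuous toMat := by
    refine continuous_matrix fun i j => ?_
    change Continuous fun b : EuclideanSpace ℂ (Fin d × Fin d) => b (i, j)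
    fun_prop
  have htrace : ∀ b, ((toMat b)ᴴ * toMat b).trace = ((‖b‖ ^ 2 : ℝ) : ℂ) := by
    intro b
    rw [EuclideanSpace.norm_sq_eq, Fintype.sum_prod_type, Finset.sum_comm]
    simp [toMat, trace, mul_apply, Complex.conj_mul']
  have hc : IsCompact (Metric.sphere (0 : EuclideanSpace ℂ (Fin d × Fin d)) 1) :=
    isCompact_sphere _ _
  convert hc.image (f := fun b => (toMat b)ᴴ * toMat b)
    (htoMat.matrix_conjTranspose.matrix_mul htoMat) using 1
  ext A
  constructor
  · rintro ⟨hA, hA1⟩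
    obtain ⟨B, hB⟩ := exists_eq_star_mul_self (nonneg_iff_posSemidef.mpr hA)
    have hb : toMat (WithLp.toLp 2 fun ij => B ij.1 ij.2) = B := rfl
    refine ⟨WithLp.toLp 2 fun ij => B ij.1 ij.2, ?_, ?_⟩
    · have h := htrace (WithLp.toLp 2 fun ij => B ij.1 ij.2)
      rw [hb, ← star_eq_conjTranspose, ← hB, hA1] at h
      have h1 : ‖WithLp.toLp 2 fun ij : Fin d × Fin d => B ij.1 ij.2‖ ^ 2 = 1 := by
        exact_mod_cast h.symm
      rw [mem_sphere_zero_iff_norm]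
      exact (pow_eq_one_iff_of_nonneg (norm_nonneg _) two_ne_zero).mp h1
    · exact hB.symm
  · rintro ⟨b, hb, rfl⟩
    refine ⟨posSemidef_conjTranspose_mul_self _, ?_⟩
    rw [htrace, mem_sphere_zero_iff_norm.mp hb]
    simp

/-- The triples `(t ω, (1 - t) ω, √t √(1 - t))` with `0 ≤ t ≤ 1` and `ω` a state. -/
def splitTriples (d : ℕ) :
    Set (Matrix (Fin d) (Fin d) ℂ × Matrix (Fin d) (Fin d) ℂ × ℝ) :=
  (fun y : ℝ × Matrix (Fin d) (Fin d) ℂ =>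
    (y.1 • y.2, (1 - y.1) • y.2, Real.sqrt y.1 * Real.sqrt (1 - y.1))) ''
    (Set.Icc 0 1 ×ˢ {A | A.PosSemidef ∧ A.trace = 1})

lemma isCompact_splitTriples (d : ℕ) : IsCompact (splitTriples d) :=
  (isCompact_Icc.prod (isCompact_states d)).image (by fun_prop)

/-- A reverse test, up to normalization, is a convex combination of split triples. -/
lemma ReverseTest.mem_convexHull {d : ℕ} {ρ σ : State d} (R : ReverseTest ρ σ) :
    ((2⁻¹ : ℝ) • ρ.1, (2⁻¹ : ℝ) • σ.1, 2⁻¹ * classicalFidelity R.p R.q) ∈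
      convexHull ℝ (splitTriples d) := by
  have hp := R.p.2.1
  have hq := R.q.2.1
  -- The outcome `x` gets weight `(a + b) / 2` and split ratio `a / (a + b)`. If `a = b = 0` the
  -- ratio is 0 by convention, harmless at weight 0.
  have hval : ∀ {a b : ℝ}, 0 ≤ a → 0 ≤ b →
      (a + b) / 2 * (a / (a + b)) = 2⁻¹ * a ∧ (a + b) / 2 * (1 - a / (a + b)) = 2⁻¹ * b ∧
      0 ≤ a / (a + b) ∧ a / (a + b) ≤ 1 ∧
      (a + b) / 2 * (Real.sqrt (a / (a + b)) * Real.sqrt (1 - a / (a + b))) =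
        2⁻¹ * (Real.sqrt a * Real.sqrt b) := by
    intro a b ha hb
    rcases (add_nonneg ha hb).eq_or_lt with h | h
    · obtain rfl : a = 0 := by linarith
      obtain rfl : b = 0 := by linarith
      simp
    · have h1 : 1 - a / (a + b) = b / (a + b) := by field_simp; ring
      refine ⟨by field_simp, by rw [h1]; field_simp, by positivity,
        (div_le_one h).mpr (by linarith), ?_⟩
      rw [h1, Real.sqrt_div ha, Real.sqrt_div hb, div_mul_div_comm, Real.mul_self_sqrt h.le]
      field_simp
  have hval' := fun x => hval (hp x) (hq x)
  let w : Fin R.card → ℝ := fun x => (R.p.1 x + R.q.1 x) / 2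
  let t : Fin R.card → ℝ := fun x => R.p.1 x / (R.p.1 x + R.q.1 x)
  let ω : Fin R.card → State d := fun x => R.chan.app (ofDist (pointMass x))
  refine mem_convexHull_of_exists_fintype w
    (fun x => (t x • (ω x).1, (1 - t x) • (ω x).1, Real.sqrt (t x) * Real.sqrt (1 - t x)))
    (fun x => div_nonneg (add_nonneg (hp x) (hq x)) two_pos.le) ?_ (fun x => ?_) ?_
  · simp only [w]
    rw [← Finset.sum_div, Finset.sum_add_distrib, R.p.2.2, R.q.2.2]
    norm_num
  · exact ⟨(t x, (ω x).1), ⟨⟨(hval' x).2.2.1, (hval' x).2.2.2.1⟩, (ω x).2⟩, rfl⟩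
  · have hρ := (congrArg Subtype.val R.map_p).symm.trans (coe_app_ofDist R.chan R.p)
    have hσ := (congrArg Subtype.val R.map_q).symm.trans (coe_app_ofDist R.chan R.q)
    rw [Prod.ext_iff, Prod.ext_iff]
    simp only [Prod.fst_sum, Prod.snd_sum, Prod.smul_fst, Prod.smul_snd]
    refine ⟨?_, ?_, ?_⟩
    · rw [hρ, Finset.smul_sum]
      refine Finset.sum_congr rfl fun x _ => ?_
      rw [smul_smul, (hval' x).1, mul_smul, Complex.coe_smul]
    · rw [hσ, Finset.smul_sum]
      refine Finset.sum_congr rfl fun x _ => ?_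
      rw [smul_smul, (hval' x).2.1, mul_smul, Complex.coe_smul]
    · rw [classicalFidelity, Finset.mul_sum]
      exact Finset.sum_congr rfl fun x _ => (hval' x).2.2.2.2

/-- Convex combinations of split triples come from reverse tests. -/
lemma exists_reverseTest_of_mem_convexHull {d : ℕ} {ρ σ : State d} {r : ℝ}
    (h : ((2⁻¹ : ℝ) • ρ.1, (2⁻¹ : ℝ) • σ.1, r) ∈ convexHull ℝ (splitTriples d)) :
    ∃ R : ReverseTest ρ σ, classicalFidelity R.p R.q = 2 * r := by
  obtain ⟨ι, _, w₀, z₀, hw₀, -, hz₀, hsum₀⟩ := mem_convexHull_iff_exists_fintype.mp h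
  let e := Fintype.equivFin ι
  obtain ⟨n, w, z, hw, hz, hsum⟩ : ∃ (n : ℕ) (w : Fin n → ℝ) (z : Fin n → _),
      (∀ i, 0 ≤ w i) ∧ (∀ i, z i ∈ splitTriples d) ∧
      ∑ i, w i • z i = ((2⁻¹ : ℝ) • ρ.1, (2⁻¹ : ℝ) • σ.1, r) :=
    ⟨_, w₀ ∘ e.symm, z₀ ∘ e.symm, fun i => hw₀ _, fun i => hz₀ _,
      (Equiv.sum_comp e.symm fun i => w₀ i • z₀ i).trans hsum₀⟩
  choose y hy hyz using hz
  obtain rfl : _ = z := funext hyz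
  rw [Prod.ext_iff, Prod.ext_iff] at hsum
  simp only [Prod.fst_sum, Prod.snd_sum, Prod.smul_fst, Prod.smul_snd] at hsum
  obtain ⟨hρ, hσ, hr⟩ := hsum
  let ω : Fin n → State d := fun i => ⟨(y i).2, (hy i).2⟩
  have hrec : ∀ (τ : State d) (c : Fin n → ℝ),
      ∑ i, w i • c i • (y i).2 = (2⁻¹ : ℝ) • τ.1 →
      τ.1 = ∑ i, ((2 * (w i * c i) : ℝ) : ℂ) • (ω i).1 := by
    intro τ c hτ
    have h2 : τ.1 = (2 : ℝ) • ((2⁻¹ : ℝ) • τ.1) := by rw [smul_smul]; norm_num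
    rw [h2, ← hτ, Finset.smul_sum]
    refine Finset.sum_congr rfl fun i _ => ?_
    rw [smul_smul, smul_smul, Complex.coe_smul, mul_assoc]
  -- Taking traces shows that the recovered weights are normalized.
  have hone : ∀ (τ : State d) (c : Fin n → ℝ),
      τ.1 = ∑ i, ((c i : ℝ) : ℂ) • (ω i).1 → ∑ i, c i = 1 := by
    intro τ c hτ
    have h3 := congrArg trace hτ
    simp_rw [τ.2.2, trace_sum, trace_smul, (ω _).2.2, smul_eq_mul, mul_one] at h3
    exact_mod_cast h3.symm
  have hp := hrec ρ (fun i => (y i).1) hρ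
  have hq := hrec σ (fun i => 1 - (y i).1) hσ
  have ht0 : ∀ i, 0 ≤ (y i).1 := fun i => (hy i).1.1
  have ht1 : ∀ i, 0 ≤ 1 - (y i).1 := fun i => sub_nonneg.mpr (hy i).1.2
  refine ⟨ReverseTest.ofStates
    ⟨_, fun i => mul_nonneg two_pos.le (mul_nonneg (hw i) (ht0 i)), hone ρ _ hp⟩
    ⟨_, fun i => mul_nonneg two_pos.le (mul_nonneg (hw i) (ht1 i)), hone σ _ hq⟩ ω hp hq, ?_⟩
  rw [← hr, Finset.mul_sum]
  refine Finset.sum_congr rfl fun i _ => ?_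
  change Real.sqrt (2 * (w i * (y i).1)) * Real.sqrt (2 * (w i * (1 - (y i).1))) =
    2 * (w i • (Real.sqrt (y i).1 * Real.sqrt (1 - (y i).1)))
  have hw2 : 0 ≤ 2 * w i := mul_nonneg two_pos.le (hw i)
  rw [← mul_assoc, ← mul_assoc, Real.sqrt_mul hw2, Real.sqrt_mul hw2, mul_mul_mul_comm,
    Real.mul_self_sqrt hw2, smul_eq_mul, mul_assoc]

lemma isCompact_reverseTestValues {d : ℕ} (ρ σ : State d) :
    IsCompact (reverseTestValues ρ σ) := by
  have hc := (isCompact_convexHull (isCompact_splitTriples d)).inter_right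
    ((isClosed_singleton (x := (2⁻¹ : ℝ) • ρ.1)).preimage continuous_fst |>.inter
      ((isClosed_singleton (x := (2⁻¹ : ℝ) • σ.1)).preimage (continuous_fst.comp continuous_snd)))
  convert hc.image (f := fun z => 2 * z.2.2) (by fun_prop) using 1
  ext r
  constructor
  · rintro ⟨R, rfl⟩
    exact ⟨_, ⟨R.mem_convexHull, rfl, rfl⟩, by ring⟩
  · rintro ⟨⟨A, B, c⟩, ⟨hz, hA, hB⟩, rfl⟩
    obtain rfl : A = _ := hA
    obtain rfl : B = _ := hB
    exact exists_reverseTest_of_mem_convexHull hz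

/-! ### Attainment, (N) and (M) for `fMin`, and its minimality. -/

lemma reverseTestValues_nonempty {d : ℕ} (ρ σ : State d) : (reverseTestValues ρ σ).Nonempty :=
  ⟨_, ReverseTest.ofStates (pointMass (0 : Fin 2)) (pointMass 1) ![ρ, σ]
    (by simp [pointMass]) (by simp [pointMass]), rfl⟩

lemma isGreatest_fMin {d : ℕ} (ρ σ : State d) : IsGreatest (reverseTestValues ρ σ) (fMin d ρ σ) :=
  (isCompact_reverseTestValues ρ σ).isGreatest_sSup (reverseTestValues_nonempty ρ σ)

lemma fMin_monotone : MonotoneCPTP fMin := by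
  intro n m Φ ρ σ
  obtain ⟨R, hR⟩ := (isGreatest_fMin ρ σ).1
  rw [← hR]
  exact (isGreatest_fMin _ _).2 ⟨⟨R.card, Φ.comp R.chan, R.p, R.q,
    by rw [Channel.comp_app, R.map_p], by rw [Channel.comp_app, R.map_q]⟩, rfl⟩

lemma re_diag_state_nonneg {d : ℕ} (ω : State d) (y : Fin d) : 0 ≤ (ω.1 y y).re :=
  (Complex.nonneg_iff.mp ω.2.1.diag_nonneg).1

/-- Classical fidelity of diagonal states bounds every reverse test. -/
lemma classicalFidelity_le_of_reverseTest {d : ℕ} {p q : PDist d}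
    (R : ReverseTest (ofDist p) (ofDist q)) :
    classicalFidelity R.p R.q ≤ classicalFidelity p q := by
  -- Reading off the diagonal turns the channel into a stochastic matrix.
  let W : Fin R.card → Fin d → ℝ := fun x y => ((R.chan.app (ofDist (pointMass x))).1 y y).re
  have hW : ∀ x y, 0 ≤ W x y := fun x y => re_diag_state_nonneg _ y
  have hW1 : ∀ x, ∑ y, W x y = 1 := fun x => by
    have h := congrArg Complex.re (R.chan.app (ofDist (pointMass x))).2.2
    simpa [trace] using h
  have hmarg : ∀ (r : PDist R.card) (s : PDist d), R.chan.app (ofDist r) = ofDist s →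
      ∀ y, s.1 y = ∑ x, r.1 x * W x y := by
    intro r s hrs y
    have h := (congrArg Subtype.val hrs).symm.trans (coe_app_ofDist R.chan r)
    have h' := congrArg (fun A => (A y y).re) h
    simp only [Matrix.sum_apply, Matrix.smul_apply, Complex.re_sum] at h'
    simpa [ofDist, W] using h'
  have hp := hmarg _ _ R.map_p
  have hq := hmarg _ _ R.map_q
  calc classicalFidelity R.p R.q
      = ∑ x, ∑ y, Real.sqrt (R.p.1 x * W x y) * Real.sqrt (R.q.1 x * W x y) := by
        refine Finset.sum_congr rfl fun x _ => ?_
        calc _ = Real.sqrt (R.p.1 x) * Real.sqrt (R.q.1 x) * ∑ y, W x y := by rw [hW1, mul_one]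
          _ = _ := by
            rw [Finset.mul_sum]
            refine Finset.sum_congr rfl fun y _ => ?_
            rw [Real.sqrt_mul (R.p.2.1 x), Real.sqrt_mul (R.q.2.1 x), mul_mul_mul_comm,
              Real.mul_self_sqrt (hW x y)]
    _ = ∑ y, ∑ x, Real.sqrt (R.p.1 x * W x y) * Real.sqrt (R.q.1 x * W x y) := Finset.sum_comm
    _ ≤ classicalFidelity p q := by
        refine Finset.sum_le_sum fun y _ => ?_
        rw [hp, hq]
        exact Real.sum_sqrt_mul_sqrt_le _ (fun x => mul_nonneg (R.p.2.1 x) (hW x y))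
          (fun x => mul_nonneg (R.q.2.1 x) (hW x y))

lemma fMin_normalized : Normalized fMin := by
  intro d p q
  refine le_antisymm ?_ ?_
  · obtain ⟨R, hR⟩ := (isGreatest_fMin (ofDist p) (ofDist q)).1
    rw [← hR]
    exact classicalFidelity_le_of_reverseTest R
  · exact (isGreatest_fMin _ _).2
      ⟨ReverseTest.ofStates p q (fun x => ofDist (pointMass x)) (coe_ofDist p) (coe_ofDist q), rfl⟩

lemma fMin_le {FQ : ∀ d : ℕ, State d → State d → ℝ} (hN : Normalized FQ) (hM : MonotoneCPTP FQ)
    {d : ℕ} (ρ σ : State d) : fMin d ρ σ ≤ FQ d ρ σ := by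
  obtain ⟨R, hR⟩ := (isGreatest_fMin ρ σ).1
  have h := hM _ _ R.chan (ofDist R.p) (ofDist R.q)
  rw [hN, R.map_p, R.map_q] at h
  exact hR ▸ h

/-! ### The Fuchs–Caves measurement and the upper bound. -/

/-- The Moore–Penrose inverse of a Hermitian matrix. -/
lemma exists_pseudoinverse {d : ℕ} {s : Matrix (Fin d) (Fin d) ℂ} (hs : IsSelfAdjoint s) :
    ∃ S : Matrix (Fin d) (Fin d) ℂ, IsSelfAdjoint S ∧ S * s = s * S ∧ s * S * s = s ∧
      S * s * S = S := by
  have hc : ∀ f : ℝ → ℝ, ContinuousOn f (spectrum ℝ s) := fun f =>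
    s.finite_real_spectrum.continuousOn f
  have hid : cfc (fun x : ℝ => x) s = s := cfc_id' ℝ s
  have h1 : cfc (fun x : ℝ => x⁻¹) s * s = cfc (fun x : ℝ => x⁻¹ * x) s := by
    nth_rewrite 2 [← hid]
    exact (cfc_mul _ _ s (hc _) (hc _)).symm
  have h2 : s * cfc (fun x : ℝ => x⁻¹) s = cfc (fun x : ℝ => x * x⁻¹) s := by
    nth_rewrite 1 [← hid]
    exact (cfc_mul _ _ s (hc _) (hc _)).symm
  have h12 : cfc (fun x : ℝ => x⁻¹) s * s = s * cfc (fun x : ℝ => x⁻¹) s := by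
    rw [h1, h2]
    simp_rw [mul_comm]
  refine ⟨cfc (fun x : ℝ => x⁻¹) s, cfc_predicate _ s, h12, ?_, ?_⟩
  · rw [h2]
    nth_rewrite 2 [← hid]
    rw [← cfc_mul _ _ s (hc _) (hc _)]
    simp_rw [mul_inv_mul_cancel]
    exact hid
  · rw [h1, ← cfc_mul _ _ s (hc _) (hc _)]
    congr 1
    ext x
    simpa using mul_inv_mul_cancel x⁻¹

lemma dotProduct_mulVec_of_isHermitian {d : ℕ} {A : Matrix (Fin d) (Fin d) ℂ}
    (hA : IsSelfAdjoint A) (u w : Fin d → ℂ) :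
    star u ⬝ᵥ A *ᵥ w = star (A *ᵥ u) ⬝ᵥ w := by
  rw [dotProduct_mulVec, star_mulVec, ← star_eq_conjTranspose, hA.star_eq]

/-- Fuchs–Caves: an operator `M ≥ 0`, supported on the projection `P`, such that `M σ M = P ρ P`
and `tr (M σ)` is the Uhlmann fidelity. -/
lemma exists_fuchsCaves_operator {d : ℕ} (ρ σ : State d) :
    ∃ M P : Matrix (Fin d) (Fin d) ℂ, M.PosSemidef ∧ IsSelfAdjoint P ∧ P * P = P ∧
      P * M = M ∧ M * P = M ∧ σ.1 * P = σ.1 ∧ M * σ.1 * M = P * ρ.1 * P ∧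
      (M * σ.1).trace.re = uhlmannFidelity ρ σ := by
  set s := CFC.sqrt σ.1 with hs_def
  have hss : s * s = σ.1 := CFC.sqrt_mul_sqrt_self _ (nonneg_iff_posSemidef.mpr σ.2.1)
  have hs : IsSelfAdjoint s := IsSelfAdjoint.of_nonneg (CFC.sqrt_nonneg _)
  set T := CFC.sqrt (s * ρ.1 * s) with hT_def
  have hT0 : 0 ≤ T := CFC.sqrt_nonneg _
  have hT : IsSelfAdjoint T := IsSelfAdjoint.of_nonneg hT0
  have hTT : T * T = s * ρ.1 * s := CFC.sqrt_mul_sqrt_self _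
    (hs.conjugate_nonneg (nonneg_iff_posSemidef.mpr ρ.2.1))
  obtain ⟨S, hS, hcomm, hsSs, hSsS⟩ := exists_pseudoinverse hs
  -- `S * s` is the support projection of `s`. Since `T * T` kills its complement, so does `T`.
  have hTP : T * (S * s) = T := by
    have h0 : T * T * (1 - S * s) = 0 := by
      rw [hTT, mul_sub, mul_one, mul_assoc (s * ρ.1) s, ← mul_assoc s S s, hsSs, sub_self]
    have h1 : (T * (1 - S * s))ᴴ * (T * (1 - S * s)) = 0 := by
      rw [conjTranspose_mul, ← star_eq_conjTranspose T, hT.star_eq, mul_assoc, ← mul_assoc T, h0,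
        mul_zero]
    have h2 := conjTranspose_mul_self_eq_zero.mp h1
    rw [mul_sub, mul_one, sub_eq_zero] at h2
    exact h2.symm
  -- This is `σ^(-1/2) √(√σ ρ √σ) σ^(-1/2)`, with a pseudoinverse because `σ` may be singular.
  refine ⟨S * T * S, S * s, ?_, ?_, ?_, ?_, ?_, ?_, ?_, ?_⟩
  · exact nonneg_iff_posSemidef.mp (hS.conjugate_nonneg hT0)
  · rw [IsSelfAdjoint, star_mul, hS.star_eq, hs.star_eq, hcomm]
  · rw [← mul_assoc, hSsS]
  · rw [← mul_assoc, ← mul_assoc, hSsS]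
  · rw [mul_assoc, ← mul_assoc S S, mul_assoc S S, hcomm, ← mul_assoc S s, hSsS]
  · rw [← hss, mul_assoc, ← mul_assoc s S, hsSs]
  · have e1 : S * T * S * σ.1 * (S * T * S) = S * ((T * (S * s)) * ((s * S) * T)) * S := by
      rw [← hss]; simp only [mul_assoc]
    have e2 : (s * S) * T = T := by
      have := congrArg star hTP
      rwa [star_mul, star_mul, hT.star_eq, hS.star_eq, hs.star_eq] at this
    rw [e1, e2, hTP, hTT]
    calc S * (s * ρ.1 * s) * S = S * s * ρ.1 * (s * S) := by simp only [mul_assoc]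
      _ = S * s * ρ.1 * (S * s) := by rw [hcomm]
  · have e1 : S * T * S * σ.1 = S * (T * (S * s) * s) := by rw [← hss]; simp only [mul_assoc]
    rw [e1, hTP, trace_mul_comm, mul_assoc, ← hcomm, hTP]
    rfl

/-- On an eigenvector of `M - (1 - P)` the classical statistics reproduce `⟨v, M σ v⟩`. -/
lemma sqrt_mul_sqrt_eq_of_eigenvector {d : ℕ} {ρ σ : State d}
    {M P : Matrix (Fin d) (Fin d) ℂ} (hM : M.PosSemidef) (hP : IsSelfAdjoint P) (hPP : P * P = P)
    (hPM : P * M = M) (hMP : M * P = M) (hσP : σ.1 * P = σ.1)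
    (hMσM : M * σ.1 * M = P * ρ.1 * P) {v : Fin d → ℂ} {c : ℝ}
    (hv : (M - (1 - P)) *ᵥ v = (c : ℂ) • v) :
    Real.sqrt (star v ⬝ᵥ ρ.1 *ᵥ v).re * Real.sqrt (star v ⬝ᵥ σ.1 *ᵥ v).re =
      (star v ⬝ᵥ (M * σ.1) *ᵥ v).re := by
  have hMsa : IsSelfAdjoint M := hM.1
  have hMv : M *ᵥ v = (c : ℂ) • P *ᵥ v := by
    rw [← mulVec_smul, ← hv, mulVec_mulVec, mul_sub, mul_sub, hPM, hPP, mul_one, sub_self, sub_zero]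
  have hQv : (1 + c : ℂ) • (v - P *ᵥ v) = 0 := by
    rw [sub_mulVec, sub_mulVec, one_mulVec, hMv] at hv
    rw [add_smul, one_smul, smul_sub, ← hv]
    abel
  rw [← mulVec_mulVec, dotProduct_mulVec_of_isHermitian hMsa]
  -- As `M ≥ 0`, a negative eigenvalue forces `P v = 0`, and both sides vanish. Otherwise `P v = v`
  -- and `M v = c v`, so the `ρ`-probability is `c ^ 2` times the `σ`-probability.
  rcases lt_or_ge c 0 with hc | hc
  · have hPv : P *ᵥ v = 0 := by
      have h1 : M *ᵥ (P *ᵥ v) = (c : ℂ) • P *ᵥ v := by rw [mulVec_mulVec, hMP, hMv]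
      have h2 := hM.re_dotProduct_nonneg (P *ᵥ v)
      rw [h1, dotProduct_smul] at h2
      have h3 : 0 ≤ star (P *ᵥ v) ⬝ᵥ (P *ᵥ v) := dotProduct_star_self_nonneg _
      have h4 := Complex.nonneg_iff.mp h3
      simp only [smul_eq_mul, RCLike.re_eq_complex_re, Complex.re_ofReal_mul] at h2
      have h5 : (star (P *ᵥ v) ⬝ᵥ (P *ᵥ v)).re = 0 := by nlinarith [h4.1]
      exact dotProduct_star_self_eq_zero.mp (Complex.ext h5 h4.2.symm)
    rw [← hσP, ← mulVec_mulVec, hPv, hMv, hPv]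
    simp
  · have hPv : P *ᵥ v = v := by
      have h1 : (1 + c : ℂ) ≠ 0 := by
        have : (1 + c : ℝ) ≠ 0 := by positivity
        exact_mod_cast this
      exact (sub_eq_zero.mp ((smul_eq_zero.mp hQv).resolve_left h1)).symm
    rw [hPv] at hMv
    have hρ : star v ⬝ᵥ ρ.1 *ᵥ v = ((c ^ 2 : ℝ) : ℂ) * (star v ⬝ᵥ σ.1 *ᵥ v) := by
      calc star v ⬝ᵥ ρ.1 *ᵥ v = star v ⬝ᵥ (P * ρ.1 * P) *ᵥ v := by
            rw [← mulVec_mulVec, ← mulVec_mulVec, dotProduct_mulVec_of_isHermitian hP, hPv]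
        _ = star v ⬝ᵥ (M * σ.1 * M) *ᵥ v := by rw [hMσM]
        _ = _ := by
            rw [← mulVec_mulVec, ← mulVec_mulVec, dotProduct_mulVec_of_isHermitian hMsa, hMv,
              mulVec_smul, star_smul, smul_dotProduct, dotProduct_smul]
            simp
            ring
    have hσ : 0 ≤ (star v ⬝ᵥ σ.1 *ᵥ v).re := σ.2.1.re_dotProduct_nonneg v
    rw [hρ, hMv, star_smul, smul_dotProduct, Complex.re_ofReal_mul, Real.sqrt_mul (sq_nonneg c),
      Real.sqrt_sq hc, mul_assoc, Real.mul_self_sqrt hσ]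
    simp

/-- The outcome distribution of a rank-one measurement. -/
def outcomeDist {d : ℕ} (v : Fin d → Fin d → ℂ)
    (hv : ∑ x, vecMulVec (v x) (star (v x)) = 1) (ρ : State d) : PDist d :=
  ⟨fun x => (star (v x) ⬝ᵥ ρ.1 *ᵥ v x).re, fun x => ρ.2.1.re_dotProduct_nonneg (v x), by
    have h := ((measurePrepare v (fun x => ofDist (pointMass x)) hv).app ρ).2.2
    rw [measurePrepare_app, trace_sum] at h
    simp_rw [trace_smul, (ofDist _).2.2, smul_eq_mul, mul_one] at h
    rw [← Complex.re_sum, h, Complex.one_re]⟩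

lemma measurePrepare_pointMass_app {d : ℕ} (v : Fin d → Fin d → ℂ)
    (hv : ∑ x, vecMulVec (v x) (star (v x)) = 1) (ρ : State d) :
    (measurePrepare v (fun x => ofDist (pointMass x)) hv).app ρ = ofDist (outcomeDist v hv ρ) := by
  refine Subtype.ext ?_
  rw [measurePrepare_app, coe_ofDist]
  refine Finset.sum_congr rfl fun x _ => ?_
  congr 1
  have h := Complex.nonneg_iff.mp (ρ.2.1.dotProduct_mulVec_nonneg (v x))
  exact Complex.ext rfl h.2.symm

lemma sum_vecMulVec_eigenvectors {d : ℕ} {N : Matrix (Fin d) (Fin d) ℂ} (hN : N.IsHermitian) :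
    ∑ x, vecMulVec (⇑(hN.eigenvectorBasis x)) (star ⇑(hN.eigenvectorBasis x)) = 1 := by
  rw [← Unitary.coe_mul_star_self hN.eigenvectorUnitary]
  ext i j
  rw [Matrix.sum_apply, mul_apply]
  rfl

/-- Some measurement reproduces the Uhlmann fidelity. -/
lemma exists_measurement_classicalFidelity_eq {d : ℕ} (ρ σ : State d) :
    ∃ (v : Fin d → Fin d → ℂ) (hv : ∑ x, vecMulVec (v x) (star (v x)) = 1),
      classicalFidelity (outcomeDist v hv ρ) (outcomeDist v hv σ) = uhlmannFidelity ρ σ := by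
  obtain ⟨M, P, hM, hP, hPP, hPM, hMP, hσP, hMσM, htr⟩ := exists_fuchsCaves_operator ρ σ
  -- Subtracting `1 - P` separates the kernel of `P` from that of `M` inside the range of `P`; an
  -- eigenbasis of `M` alone could mix them.
  have hN : (M - (1 - P)).IsHermitian := hM.1.sub (isHermitian_one.sub hP)
  refine ⟨fun x => ⇑(hN.eigenvectorBasis x), sum_vecMulVec_eigenvectors hN, ?_⟩
  rw [← htr, trace_eq_sum_dotProduct (sum_vecMulVec_eigenvectors hN), Complex.re_sum]
  refine Finset.sum_congr rfl fun x _ => ?_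
  refine sqrt_mul_sqrt_eq_of_eigenvector hM hP hPP hPM hMP hσP hMσM (c := hN.eigenvalues x) ?_
  exact hN.mulVec_eigenvectorBasis x

lemma le_uhlmannFidelity {FQ : ∀ d : ℕ, State d → State d → ℝ} (hN : Normalized FQ)
    (hM : MonotoneCPTP FQ) {d : ℕ} (ρ σ : State d) : FQ d ρ σ ≤ uhlmannFidelity ρ σ := by
  obtain ⟨v, hv, h⟩ := exists_measurement_classicalFidelity_eq ρ σ
  have := hM _ _ (measurePrepare v (fun x => ofDist (pointMass x)) hv) ρ σ
  rwa [measurePrepare_pointMass_app, measurePrepare_pointMass_app, hN, h] at this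

end QFid

end

theorem mainTheorem2 :
    (∀ FQ : (∀ d : ℕ, QFid.State d → QFid.State d → ℝ),
      QFid.Normalized FQ → QFid.MonotoneCPTP FQ →
        ∀ (d : ℕ) (ρ σ : QFid.State d),
          QFid.fMin d ρ σ ≤ FQ d ρ σ ∧ FQ d ρ σ ≤ QFid.uhlmannFidelity ρ σ) ∧
    (∀ (d : ℕ) (ρ σ : QFid.State d),
      IsGreatest (QFid.reverseTestValues ρ σ) (QFid.fMin d ρ σ)) ∧
    QFid.Normalized QFid.fMin ∧
    QFid.MonotoneCPTP QFid.fMin := by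
  exact ⟨fun _ hN hM _ ρ σ => ⟨QFid.fMin_le hN hM ρ σ, QFid.le_uhlmannFidelity hN hM ρ σ⟩,
    fun _ ρ σ => QFid.isGreatest_fMin ρ σ, QFid.fMin_normalized, QFid.fMin_monotone⟩
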